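/- Conventions. Vocabularies are finite sets of predicate, function and constant symbols; structures have non-empty universes; $|\varphi|$ is the length (number of symbol occurrences) of a first-order sentence $\varphi$, so that $|\neg\varphi| = |\varphi|+1$; $N \subseteq M$ means that $N$ is a substructure of $M$. Let $k \in \mathbb{N}$. Let $R$ be a collection of substructures of a structure $M$. $M$ is a \emph{$k$-ary covered extension} of $R$ if $R$ is non-empty and every set of at most $k$ elements of $M$ is contained in some $N \in R$. $M$ is a \emph{finitary covered extension} of $R$ if every finite set of elements of $M$ is contained in some $N \in R$. A first-order sentence $\varphi$ is in $PCE(k)$ (respectively in $PCE_f$) if, whenever $M$ is a $k$-ary (respectively finitary) covered extension of a collection $R$ of models of $\varphi$, then $M \models \varphi$. Dually, $\varphi$ is in $PSC(k)$ (respectively in $PSC_f$) if every model $M$ of $\varphi$ has a set $C$ of at most $k$ elements (respectively a finite set $C$) such that every $N \subseteq M$ that contains $C$ is a model of $\varphi$. Lemma. For every recursive function $f : \mathbb{N} \to \mathbb{N}$: (1) there are a finite vocabulary and a sentence $\varphi \in PCE_f$ over it such that $\varphi \notin PCE(k)$ for every $k \le f(|\varphi|)$; (2) there are a finite vocabulary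 and a sentence $\varphi \in PSC_f$ over it such that $\varphi \notin PSC(k)$ for every $k \le f(|\varphi|)$. -/

import Mathlib

open FirstOrder

universe x

namespace CoveredExt

universe u v w

section Length

variable {L : FirstOrder.Language.{u, v}} {α : Type w}

/-- Number of symbol occurrences in a term (every variable and every function symbol counts 1). -/
def termLength {β : Type w} : L.Term β → ℕ
  | .var _ => 1
  | .func _ ts => 1 + ∑ i, termLength (ts i)

/-- Number of symbol occurrences in a first-order formula, written in prefix notation with
the logical symbols `⊥`, `=`, `→`, `¬`, `∀`. The formula `¬ φ`, which Mathlib represents as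
`φ → ⊥`, has length `|φ| + 1`. A quantifier `∀ x` counts 2 (the symbol and its variable). -/
def length : {n : ℕ} → L.BoundedFormula α n → ℕ
  | _, .falsum => 1
  | _, .equal s t => 1 + termLength s + termLength t
  | _, .rel _ ts => 1 + ∑ i, termLength (ts i)
  | _, .imp φ .falsum => length φ + 1
  | _, .imp φ ψ => 1 + length φ + length ψ
  | _, .all φ => 2 + length φ

end Length

section Classes

variable {L : FirstOrder.Language.{u, v}}

/-- A class of (non-empty) structures over the vocabulary `L`. -/
abbrev StructureClass (L : FirstOrder.Language.{u, v}) := Set (CategoryTheory.Bundled.{x} L.Structure)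

/-- `M` is an extension of the collection `R` of structures: each member of `R` is a (non-empty)
substructure of `M`. The members are given directly as substructures of `M`, so only
non-emptiness of their universes has to be said. -/
def IsExtension {M : Type x} [L.Structure M] (R : Set (L.Substructure M)) : Prop :=
  ∀ N ∈ R, (N : Set M).Nonempty

/-- `M` is a `k`-ary covered extension of the non-empty collection `R`. -/
def IsCoveredExtension {M : Type x} [L.Structure M] (k : ℕ) (R : Set (L.Substructure M)) : Prop :=
  R.Nonempty ∧ IsExtension R ∧
    ∀ A : Finset M, A.card ≤ k → ∃ N ∈ R, (A : Set M) ⊆ (N : Set M)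

/-- `M` is a finitary covered extension of the collection `R`. -/
def IsFinitaryCoveredExtension {M : Type x} [L.Structure M] (R : Set (L.Substructure M)) : Prop :=
  IsExtension R ∧ ∀ A : Finset M, ∃ N ∈ R, (A : Set M) ⊆ (N : Set M)

/-- Preservation under `k`-ary covered extensions. -/
def PreservedUnderCovered (k : ℕ) (S : StructureClass.{x, u, v} L) : Prop :=
  ∀ (M : Type x) [Nonempty M] [L.Structure M] (R : Set (L.Substructure M)),
    IsCoveredExtension k R → (∀ N ∈ R, CategoryTheory.Bundled.of (c := L.Structure) N ∈ S) →
      CategoryTheory.Bundled.of (c := L.Structure) M ∈ S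

/-- Preservation under finitary covered extensions. -/
def PreservedUnderFinitaryCovered (S : StructureClass.{x, u, v} L) : Prop :=
  ∀ (M : Type x) [Nonempty M] [L.Structure M] (R : Set (L.Substructure M)),
    IsFinitaryCoveredExtension R →
      (∀ N ∈ R, CategoryTheory.Bundled.of (c := L.Structure) N ∈ S) →
        CategoryTheory.Bundled.of (c := L.Structure) M ∈ S

/-- `C` is a core of `M` with respect to the class `S`: every (non-empty) substructure of `M`
that contains `C` belongs to `S`. -/
def IsCore {M : Type x} [L.Structure M] (S : StructureClass.{x, u, v} L) (C : Finset M) : Prop :=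
  ∀ N : L.Substructure M, (N : Set M).Nonempty → (C : Set M) ⊆ (N : Set M) →
    CategoryTheory.Bundled.of (c := L.Structure) N ∈ S

/-- Preservation under substructures modulo `k`-sized cores. -/
def PreservedUnderSubModCore (k : ℕ) (S : StructureClass.{x, u, v} L) : Prop :=
  ∀ (M : Type x) [Nonempty M] [L.Structure M],
    CategoryTheory.Bundled.of (c := L.Structure) M ∈ S →
      ∃ C : Finset M, C.card ≤ k ∧ IsCore S C

/-- Preservation under substructures modulo a finite core. -/
def PreservedUnderSubModFiniteCore (S : StructureClass.{x, u, v} L) : Prop :=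
  ∀ (M : Type x) [Nonempty M] [L.Structure M],
    CategoryTheory.Bundled.of (c := L.Structure) M ∈ S → ∃ C : Finset M, IsCore S C

/-- The class of (non-empty) models of a sentence. -/
def modelClass (φ : L.Sentence) : StructureClass.{x, u, v} L :=
  {M | Nonempty M ∧ M ⊨ φ}

/-- The sentences whose class of models is preserved under `k`-ary covered extensions. -/
def PCE (L : FirstOrder.Language.{u, v}) (k : ℕ) : Set L.Sentence :=
  {φ | PreservedUnderCovered k (modelClass.{x, u, v} φ)}

/-- The sentences whose class of models is preserved under finitary covered extensions. -/
def PCEf (L : FirstOrder.Language.{u, v}) : Set L.Sentence :=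
  {φ | PreservedUnderFinitaryCovered (modelClass.{x, u, v} φ)}

/-- The sentences whose class of models is preserved under substructures modulo `k`-sized
cores. -/
def PSC (L : FirstOrder.Language.{u, v}) (k : ℕ) : Set L.Sentence :=
  {φ | PreservedUnderSubModCore k (modelClass.{x, u, v} φ)}

/-- The sentences whose class of models is preserved under substructures modulo a finite
core. -/
def PSCf (L : FirstOrder.Language.{u, v}) : Set L.Sentence :=
  {φ | PreservedUnderSubModFiniteCore (modelClass.{x, u, v} φ)}

end Classes

end CoveredExt

/-!
By duality it is enough to find `φ ∈ PSC_f` with a model all of whose cores have more than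
`max (f |φ|) (f (|φ| + 1))` elements, and then to take `¬φ` for covered extensions: a model of `φ`
has no core of size at most `k` exactly if it is a `k`-ary covered extension of its substructures
refuting `φ` (`neg_mem_PCEf_of_mem_PSCf`, `mem_PSC_of_neg_mem_PCE`).

The sentence `runSentence n c` concerns the computation of the program with number `c` at the input
`n`, over a fixed finite relational vocabulary. It says that if two universal sentences hold, then
the structure is complete: there are a zero and an element marked as output, and every non-maximal
element has a successor. The first universal sentence says that the structure is totally ordered,
that outputs are maximal, and that the Horn clauses of a universal interpreter for
`Nat.Partrec.Code` hold; the second says that the value of program `c` at `n` is an output.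

* If the computation halts, a complete structure satisfying both universal sentences is finite
  (`finite_of_complete`). Otherwise the iterated successors of its zero form a copy of `ℕ`, on which
  the Horn clauses derive the true value `G` (`IsChain.eval`), so `G` is an output although its
  successor lies above it. Hence a model of `runSentence n c` either refutes a universal sentence,
  and a finite witness of this is a core, or it is finite and is itself a core
  (`runSentence_mem_PSCf`).
* The standard structure on `{0, …, G}` is complete. Its proper substructures still satisfy both
  universal sentences (`IsStandard.obeysRules`, `IsStandard.realize_outSentence`), but are incomplete
  (`IsStandard.exists_eq_of_complete`). So its only core is the whole structure
  (`runSentence_notMem_PSC`).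

Since the interpreter is universal, the length of `runSentence n c` is at most `6 * n + B` with `B`
independent of the program (`length_runSentence_le`). For a program computing a sum of the values of
`f` up to a quadratic bound and for `n` large, the value `G` at `n` exceeds `f |φ|` and
`f (|φ| + 1)`.
-/

namespace CoveredExt

open FirstOrder.Language

/-! ### A vocabulary for computations -/

/-- Relation symbols speaking about an initial segment of `ℕ`: `tag i` is the number `i`, `lt` and
`succ` are the order and the successor, `pair` is the graph of `Nat.pair`, `eval c x y` says that
the program numbered `c` maps `x` to `y`, and `out` marks the output of the computation. -/
inductive RunRel : ℕ → Type
  | tag (i : Fin 5) : RunRel 1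
  | out : RunRel 1
  | lt : RunRel 2
  | succ : RunRel 2
  | pair : RunRel 3
  | eval : RunRel 3

/-- The relational vocabulary with the symbols `RunRel`. -/
def runLang : FirstOrder.Language.{0, 0} := ⟨fun _ => Empty, RunRel⟩

instance : Finite runLang.Symbols := by
  have h : Finite (Σ k, runLang.Relations k) := by
    refine Finite.of_surjective
      (fun o : Fin 5 ⊕ Fin 5 => (match o with
        | .inl i => ⟨1, RunRel.tag i⟩
        | .inr 0 => ⟨1, RunRel.out⟩
        | .inr 1 => ⟨2, RunRel.lt⟩
        | .inr 2 => ⟨2, RunRel.succ⟩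
        | .inr 3 => ⟨3, RunRel.pair⟩
        | .inr 4 => ⟨3, RunRel.eval⟩ : Σ k, runLang.Relations k)) ?_
    rintro ⟨k, r⟩
    cases (r : RunRel k) with
    | tag i => exact ⟨.inl i, rfl⟩
    | out => exact ⟨.inr 0, rfl⟩
    | lt => exact ⟨.inr 1, rfl⟩
    | succ => exact ⟨.inr 2, rfl⟩
    | pair => exact ⟨.inr 3, rfl⟩
    | eval => exact ⟨.inr 4, rfl⟩
  have : Finite (Σ k, runLang.Functions k) :=
    @Finite.of_subsingleton _ ⟨fun a => (show Empty from a.2).elim⟩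
  exact inferInstanceAs (Finite (_ ⊕ _))

section Semantics

variable {M : Type*} [runLang.Structure M]

/-- `Structure.RelMap` for `runLang`, with the relation symbol typed as a `RunRel`. -/
def Holds {k : ℕ} (r : RunRel k) (w : Fin k → M) : Prop := Structure.RelMap (L := runLang) r w

/-! The symbols of `runLang` as relations on a structure, and below as atomic formulas. -/

def Tag (i : Fin 5) (a : M) : Prop := Holds (RunRel.tag i) ![a]
def Out (a : M) : Prop := Holds RunRel.out ![a]
def Lt (a b : M) : Prop := Holds RunRel.lt ![a, b]
def Succ (a b : M) : Prop := Holds RunRel.succ ![a, b]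
def Pair (a b p : M) : Prop := Holds RunRel.pair ![a, b, p]
def Eval (c a b : M) : Prop := Holds RunRel.eval ![c, a, b]

end Semantics

/-- The atomic formula that applies `r` to the variables listed by `v`. -/
def atom {q k : ℕ} (r : RunRel k) (v : Fin k → Fin q) : runLang.BoundedFormula Empty q :=
  .rel (L := runLang) r fun i => .var (.inr (v i))

section Atoms

variable {q : ℕ}

def tagF (i : Fin 5) (a : Fin q) := atom (.tag i) ![a]
def outF (a : Fin q) := atom .out ![a]
def ltF (a b : Fin q) := atom .lt ![a, b]
def succF (a b : Fin q) := atom .succ ![a, b]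
def pairF (a b p : Fin q) := atom .pair ![a, b, p]
def evalF (c a b : Fin q) := atom .eval ![c, a, b]
def eqF (a b : Fin q) : runLang.BoundedFormula Empty q := .equal (.var (.inr a)) (.var (.inr b))

variable {M : Type*} [runLang.Structure M] {v : Empty → M} {xs : Fin q → M}

theorem realize_atom {k : ℕ} {r : RunRel k} {w : Fin k → Fin q} :
    (atom r w).Realize v xs ↔ Holds r (xs ∘ w) := Iff.rfl

@[simp] theorem realize_tagF {i : Fin 5} {a : Fin q} :
    (tagF i a).Realize v xs ↔ Tag i (xs a) := by
  rw [tagF, realize_atom, ← FinVec.map_eq]; rfl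

@[simp] theorem realize_outF {a : Fin q} : (outF a).Realize v xs ↔ Out (xs a) := by
  rw [outF, realize_atom, ← FinVec.map_eq]; rfl

@[simp] theorem realize_ltF {a b : Fin q} : (ltF a b).Realize v xs ↔ Lt (xs a) (xs b) := by
  rw [ltF, realize_atom, ← FinVec.map_eq]; rfl

@[simp] theorem realize_succF {a b : Fin q} : (succF a b).Realize v xs ↔ Succ (xs a) (xs b) := by
  rw [succF, realize_atom, ← FinVec.map_eq]; rfl

@[simp] theorem realize_pairF {a b p : Fin q} :
    (pairF a b p).Realize v xs ↔ Pair (xs a) (xs b) (xs p) := by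
  rw [pairF, realize_atom, ← FinVec.map_eq]; rfl

@[simp] theorem realize_evalF {c a b : Fin q} :
    (evalF c a b).Realize v xs ↔ Eval (xs c) (xs a) (xs b) := by
  rw [evalF, realize_atom, ← FinVec.map_eq]; rfl

@[simp] theorem realize_eqF {a b : Fin q} : (eqF a b).Realize v xs ↔ xs a = xs b := Iff.rfl

theorem isQF_atom {k : ℕ} (r : RunRel k) (w : Fin k → Fin q) : (atom r w).IsQF :=
  .of_isAtomic (.rel (L := runLang) _ _)

theorem isQF_eqF (a b : Fin q) : (eqF a b).IsQF := .of_isAtomic (.equal _ _)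

end Atoms

/-! ### Universal rules of evaluation -/

/-- The quantifier-free rules, in the variables `0, …, 13`: the order rules say
that `lt` is total and compatible with `succ` and that an output is maximal, and the remaining
Horn clauses compute the tags, the pairing function and the evaluation of programs. -/
def rules : List (runLang.BoundedFormula Empty 14) :=
  [ltF 0 1 ⊔ (eqF 0 1 ⊔ ltF 1 0),
   succF 0 1 ⟹ ltF 0 1,
   succF 0 1 ⟹ ltF 0 2 ⟹ ∼(ltF 2 1),
   tagF 0 0 ⟹ ∼(ltF 1 0),
   ltF 0 1 ⟹ succF 1 2 ⟹ ltF 0 2,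
   outF 0 ⟹ ∼(ltF 0 1),
   tagF 0 0 ⟹ succF 0 1 ⟹ tagF 1 1,
   tagF 1 0 ⟹ succF 0 1 ⟹ tagF 2 1,
   tagF 2 0 ⟹ succF 0 1 ⟹ tagF 3 1,
   tagF 3 0 ⟹ succF 0 1 ⟹ tagF 4 1,
   tagF 0 0 ⟹ pairF 0 0 0,
   tagF 0 0 ⟹ pairF 1 1 2 ⟹ succF 1 3 ⟹ succF 2 4 ⟹ pairF 0 3 4,
   pairF 0 1 2 ⟹ succF 0 3 ⟹ ltF 3 1 ⟹ succF 2 4 ⟹ pairF 3 1 4,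
   tagF 0 0 ⟹ succF 1 2 ⟹ pairF 1 2 3 ⟹ succF 3 4 ⟹ pairF 2 0 4,
   pairF 0 1 2 ⟹ ltF 1 0 ⟹ succF 1 3 ⟹ succF 2 4 ⟹ pairF 0 3 4,
   tagF 0 0 ⟹ pairF 0 0 1 ⟹ evalF 1 2 0,
   tagF 0 0 ⟹ tagF 1 1 ⟹ pairF 0 1 2 ⟹ succF 3 4 ⟹ evalF 2 3 4,
   tagF 0 0 ⟹ tagF 2 1 ⟹ pairF 0 1 2 ⟹ pairF 3 4 5 ⟹ evalF 2 5 3,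
   tagF 0 0 ⟹ tagF 3 1 ⟹ pairF 0 1 2 ⟹ pairF 3 4 5 ⟹ evalF 2 5 4,
   tagF 1 0 ⟹ pairF 1 2 3 ⟹ pairF 0 3 4 ⟹ evalF 1 5 6 ⟹ evalF 2 5 7 ⟹ pairF 6 7 8 ⟹
     evalF 4 5 8,
   tagF 2 0 ⟹ pairF 1 2 3 ⟹ pairF 0 3 4 ⟹ evalF 2 5 6 ⟹ evalF 1 6 7 ⟹ evalF 4 5 7,
   tagF 3 0 ⟹ pairF 1 2 3 ⟹ pairF 0 3 4 ⟹ tagF 0 5 ⟹ pairF 6 5 7 ⟹ evalF 1 6 8 ⟹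
     evalF 4 7 8,
   tagF 3 0 ⟹ pairF 1 2 3 ⟹ pairF 0 3 4 ⟹ succF 5 6 ⟹ pairF 7 5 8 ⟹ pairF 7 6 9 ⟹
     evalF 4 8 10 ⟹ pairF 5 10 11 ⟹ pairF 7 11 12 ⟹ evalF 2 12 13 ⟹ evalF 4 9 13,
   tagF 4 0 ⟹ pairF 0 1 2 ⟹ pairF 3 4 5 ⟹ evalF 1 5 6 ⟹ tagF 0 6 ⟹ evalF 2 5 4,
   tagF 4 0 ⟹ pairF 0 1 2 ⟹ pairF 3 4 5 ⟹ evalF 1 5 6 ⟹ succF 7 6 ⟹ succF 4 8 ⟹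
     pairF 3 8 9 ⟹ evalF 2 9 10 ⟹ evalF 2 5 10]

/-- The semantic content of `rules`, field by field. -/
structure ObeysRules (M : Type*) [runLang.Structure M] : Prop where
  total (a b : M) : Lt a b ∨ a = b ∨ Lt b a
  lt_of_succ {a b : M} : Succ a b → Lt a b
  no_between {a b c : M} : Succ a b → Lt a c → ¬ Lt c b
  zero_min {a b : M} : Tag 0 a → ¬ Lt b a
  lt_succ {a b c : M} : Lt a b → Succ b c → Lt a c
  out_max {a b : M} : Out a → ¬ Lt a b
  tag1 {a b : M} : Tag 0 a → Succ a b → Tag 1 b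
  tag2 {a b : M} : Tag 1 a → Succ a b → Tag 2 b
  tag3 {a b : M} : Tag 2 a → Succ a b → Tag 3 b
  tag4 {a b : M} : Tag 3 a → Succ a b → Tag 4 b
  pair_zero {a : M} : Tag 0 a → Pair a a a
  pair_col {z b p b' p' : M} : Tag 0 z → Pair b b p → Succ b b' → Succ p p' → Pair z b' p'
  pair_left {a b p a' p' : M} : Pair a b p → Succ a a' → Lt a' b → Succ p p' → Pair a' b p'
  pair_row {z a a' p p' : M} : Tag 0 z → Succ a a' → Pair a a' p → Succ p p' → Pair a' z p'
  pair_right {a b p b' p' : M} : Pair a b p → Lt b a → Succ b b' → Succ p p' → Pair a b' p'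
  eval_zero {z c a : M} : Tag 0 z → Pair z z c → Eval c a z
  eval_succ {z t c a b : M} : Tag 0 z → Tag 1 t → Pair z t c → Succ a b → Eval c a b
  eval_left {z t c a b p : M} : Tag 0 z → Tag 2 t → Pair z t c → Pair a b p → Eval c p a
  eval_right {z t c a b p : M} : Tag 0 z → Tag 3 t → Pair z t c → Pair a b p → Eval c p b
  eval_pair {t f g p c a y z w : M} : Tag 1 t → Pair f g p → Pair t p c → Eval f a y →
    Eval g a z → Pair y z w → Eval c a w
  eval_comp {t f g p c a y z : M} : Tag 2 t → Pair f g p → Pair t p c → Eval g a y →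
    Eval f y z → Eval c a z
  eval_prec_zero {t f g p c z a x y : M} : Tag 3 t → Pair f g p → Pair t p c → Tag 0 z →
    Pair a z x → Eval f a y → Eval c x y
  eval_prec_succ {t f g p c m n a x x' y u w z : M} : Tag 3 t → Pair f g p → Pair t p c →
    Succ m n → Pair a m x → Pair a n x' → Eval c x y → Pair m y u → Pair a u w → Eval g w z →
    Eval c x' z
  eval_rfind_zero {t f c a m x z : M} : Tag 4 t → Pair t f c → Pair a m x → Eval f x z →
    Tag 0 z → Eval c x m
  eval_rfind_succ {t f c a m x y u n x' w : M} : Tag 4 t → Pair t f c → Pair a m x → Eval f x y →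
    Succ u y → Succ m n → Pair a n x' → Eval c x' w → Eval c x w

/-- The universal closure of the conjunction of `rules`. -/
def rulesSentence : runLang.Sentence :=
  (rules.foldr (· ⊓ ·) ⊤).alls

theorem realize_rulesSentence {M : Type*} [Nonempty M] [runLang.Structure M] :
    M ⊨ rulesSentence ↔ ObeysRules M := by
  have key : M ⊨ rulesSentence ↔
      ∀ xs : Fin 14 → M, ∀ φ ∈ rules, φ.Realize default xs := by
    rw [Sentence.Realize, rulesSentence, BoundedFormula.realize_alls]
    simp only [BoundedFormula.realize_foldr_inf]
  rw [key]
  constructor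
  · intro h
    simp only [rules, List.forall_mem_cons, BoundedFormula.realize_imp, BoundedFormula.realize_sup,
      BoundedFormula.realize_not, realize_tagF, realize_outF, realize_ltF, realize_succF,
      realize_pairF, realize_evalF, realize_eqF] at h
    obtain ⟨o⟩ := ‹Nonempty M›
    -- The fixed element `o` fills the variables that a rule does not mention.
    replace h := fun l : List M => h fun i => l.getD i o
    simp only [forall_and] at h
    obtain ⟨r0, r1, r2, r3, r4, r5, r6, r7, r8, r9, r10, r11, r12, r13, r14, r15, r16, r17,
      r18, r19, r20, r21, r22, r23, r24, -⟩ := h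
    exact ⟨fun a b => r0 [a, b],
      fun {a b} => r1 [a, b],
      fun {a b c} => r2 [a, b, c],
      fun {a b} => r3 [a, b],
      fun {a b c} => r4 [a, b, c],
      fun {a b} => r5 [a, b],
      fun {a b} => r6 [a, b],
      fun {a b} => r7 [a, b],
      fun {a b} => r8 [a, b],
      fun {a b} => r9 [a, b],
      fun {a} => r10 [a],
      fun {z b p b' p'} => r11 [z, b, p, b', p'],
      fun {a b p a' p'} => r12 [a, b, p, a', p'],
      fun {z a a' p p'} => r13 [z, a, a', p, p'],
      fun {a b p b' p'} => r14 [a, b, p, b', p'],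
      fun {z c a} => r15 [z, c, a],
      fun {z t c a b} => r16 [z, t, c, a, b],
      fun {z t c a b p} => r17 [z, t, c, a, b, p],
      fun {z t c a b p} => r18 [z, t, c, a, b, p],
      fun {t f g p c a y z w} => r19 [t, f, g, p, c, a, y, z, w],
      fun {t f g p c a y z} => r20 [t, f, g, p, c, a, y, z],
      fun {t f g p c z a x y} => r21 [t, f, g, p, c, z, a, x, y],
      fun {t f g p c m n a x x' y u w z} => r22 [t, f, g, p, c, m, n, a, x, x', y, u, w, z],
      fun {t f c a m x z} => r23 [t, f, c, a, m, x, z],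
      fun {t f c a m x y u n x' w} => r24 [t, f, c, a, m, x, y, u, n, x', w]⟩
  · intro h xs
    simp only [rules, List.forall_mem_cons, BoundedFormula.realize_imp, BoundedFormula.realize_sup,
      BoundedFormula.realize_not, realize_tagF, realize_outF, realize_ltF, realize_succF,
      realize_pairF, realize_evalF, realize_eqF]
    exact ⟨h.total _ _, h.lt_of_succ, h.no_between, h.zero_min, h.lt_succ, h.out_max, h.tag1,
      h.tag2, h.tag3, h.tag4, h.pair_zero, h.pair_col, h.pair_left, h.pair_row, h.pair_right,
      h.eval_zero, h.eval_succ, h.eval_left, h.eval_right, h.eval_pair, h.eval_comp,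
      h.eval_prec_zero, h.eval_prec_succ, h.eval_rfind_zero, h.eval_rfind_succ, by simp⟩

/-! ### Numbering programs -/

section Numbering

open Nat.Partrec

/-- A numbering of programs by nested pairs, whose outer component is a tag below `5`. -/
def codeNum : Code → ℕ
  | .zero => Nat.pair 0 0
  | .succ => Nat.pair 0 1
  | .left => Nat.pair 0 2
  | .right => Nat.pair 0 3
  | .pair f g => Nat.pair 1 (Nat.pair (codeNum f) (codeNum g))
  | .comp f g => Nat.pair 2 (Nat.pair (codeNum f) (codeNum g))
  | .prec f g => Nat.pair 3 (Nat.pair (codeNum f) (codeNum g))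
  | .rfind' f => Nat.pair 4 (codeNum f)

/-- The program with a given number. It is total, so that the rules for `Code.prec` remain true of
numbers that are not of the form `codeNum c`; the value there is irrelevant. -/
def numCode (n : ℕ) : Code :=
  if h₀ : n.unpair.1 = 0 then
    match n.unpair.2 with
    | 0 => .zero
    | 1 => .succ
    | 2 => .left
    | _ => .right
  else
    have hn : n.unpair.2 < n := by
      conv_rhs => rw [← Nat.pair_unpair n]
      exact (Nat.right_le_pair 0 _).trans_lt (Nat.pair_lt_pair_left _ (Nat.pos_of_ne_zero h₀))
    have h₁ : n.unpair.2.unpair.1 < n := (Nat.unpair_left_le _).trans_lt hn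
    have h₂ : n.unpair.2.unpair.2 < n := (Nat.unpair_right_le _).trans_lt hn
    match n.unpair.1 with
    | 1 => .pair (numCode n.unpair.2.unpair.1) (numCode n.unpair.2.unpair.2)
    | 2 => .comp (numCode n.unpair.2.unpair.1) (numCode n.unpair.2.unpair.2)
    | 3 => .prec (numCode n.unpair.2.unpair.1) (numCode n.unpair.2.unpair.2)
    | _ => .rfind' (numCode n.unpair.2)

theorem numCode_zero : numCode (Nat.pair 0 0) = .zero := by
  rw [numCode]; simp

theorem numCode_succ : numCode (Nat.pair 0 1) = .succ := by
  rw [numCode]; simp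

theorem numCode_left : numCode (Nat.pair 0 2) = .left := by
  rw [numCode]; simp

theorem numCode_right : numCode (Nat.pair 0 3) = .right := by
  rw [numCode]; simp

theorem numCode_pair (f g : ℕ) :
    numCode (Nat.pair 1 (Nat.pair f g)) = .pair (numCode f) (numCode g) := by
  rw [numCode]; simp

theorem numCode_comp (f g : ℕ) :
    numCode (Nat.pair 2 (Nat.pair f g)) = .comp (numCode f) (numCode g) := by
  rw [numCode]; simp

theorem numCode_prec (f g : ℕ) :
    numCode (Nat.pair 3 (Nat.pair f g)) = .prec (numCode f) (numCode g) := by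
  rw [numCode]; simp

theorem numCode_rfind' (f : ℕ) : numCode (Nat.pair 4 f) = .rfind' (numCode f) := by
  rw [numCode]; simp

theorem numCode_codeNum (c : Code) : numCode (codeNum c) = c := by
  induction c with
  | zero => exact numCode_zero
  | succ => exact numCode_succ
  | left => exact numCode_left
  | right => exact numCode_right
  | pair f g hf hg => rw [codeNum, numCode_pair, hf, hg]
  | comp f g hf hg => rw [codeNum, numCode_comp, hf, hg]
  | prec f g hf hg => rw [codeNum, numCode_prec, hf, hg]
  | rfind' f hf => rw [codeNum, numCode_rfind', hf]

theorem mem_eval_pair {f g : Code} {a w : ℕ} :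
    w ∈ (Code.pair f g).eval a ↔ ∃ y ∈ f.eval a, ∃ z ∈ g.eval a, Nat.pair y z = w := by
  simp [Code.eval, Seq.seq]

theorem mem_eval_comp {f g : Code} {a w : ℕ} :
    w ∈ (Code.comp f g).eval a ↔ ∃ y ∈ g.eval a, w ∈ f.eval y := by
  simp only [Code.eval]
  exact Part.mem_bind_iff

theorem mem_eval_prec_succ {f g : Code} {a n w : ℕ} :
    w ∈ (Code.prec f g).eval (Nat.pair a (n + 1)) ↔
      ∃ y ∈ (Code.prec f g).eval (Nat.pair a n), w ∈ g.eval (Nat.pair a (Nat.pair n y)) := by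
  rw [Code.eval_prec_succ]; simp

/-- `Code.rfind' f` searches upwards from the second component of its argument. -/
theorem mem_eval_rfind' {f : Code} {a m w : ℕ} :
    w ∈ (Code.rfind' f).eval (Nat.pair a m) ↔ ∃ k, (0 ∈ f.eval (Nat.pair a (k + m)) ∧
      ∀ i < k, ∃ y, y + 1 ∈ f.eval (Nat.pair a (i + m))) ∧ k + m = w := by
  have h (o : Part ℕ) : (∃ y ∈ o, ¬ y = 0) ↔ ∃ y, y + 1 ∈ o :=
    ⟨fun ⟨y, hy, h0⟩ => ⟨y - 1, by rwa [Nat.sub_add_cancel (Nat.pos_of_ne_zero h0)]⟩,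
      fun ⟨y, hy⟩ => ⟨y + 1, hy, by simp⟩⟩
  have h' (k : ℕ) : k ∈ Nat.rfind (fun n => Part.map (fun m => decide (m = 0))
      (f.eval (Nat.pair a (n + m)))) ↔ 0 ∈ f.eval (Nat.pair a (k + m)) ∧
      ∀ i < k, ∃ y ∈ f.eval (Nat.pair a (i + m)), ¬ y = 0 := by
    refine Nat.mem_rfind.trans ?_
    simp
  simp [Code.eval, ← h, h']

theorem mem_eval_rfind'_of_zero {f : Code} {a m : ℕ} (h : 0 ∈ f.eval (Nat.pair a m)) :
    m ∈ (Code.rfind' f).eval (Nat.pair a m) :=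
  mem_eval_rfind'.2 ⟨0, ⟨by simpa using h, by simp⟩, by simp⟩

theorem mem_eval_rfind'_of_succ {f : Code} {a m y w : ℕ} (h : y + 1 ∈ f.eval (Nat.pair a m))
    (hw : w ∈ (Code.rfind' f).eval (Nat.pair a (m + 1))) :
    w ∈ (Code.rfind' f).eval (Nat.pair a m) := by
  obtain ⟨k, ⟨h0, hk⟩, rfl⟩ := mem_eval_rfind'.1 hw
  refine mem_eval_rfind'.2 ⟨k + 1, ⟨by rwa [add_assoc, add_comm 1], fun i hi => ?_⟩, by ring⟩
  cases i with
  | zero => exact ⟨y, by simpa using h⟩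
  | succ i =>
    obtain ⟨z, hz⟩ := hk i (by omega)
    exact ⟨z, by rwa [add_assoc, add_comm 1]⟩

end Numbering

/-! ### The pairing function along its enumeration -/

theorem pair_zero_succ (b : ℕ) : Nat.pair 0 (b + 1) = Nat.pair b b + 1 := by
  simp [Nat.pair]; ring

theorem pair_succ_left {a b : ℕ} (h : a + 1 < b) : Nat.pair (a + 1) b = Nat.pair a b + 1 := by
  simp [Nat.pair, h, (Nat.lt_succ_self a).trans h]; ring

theorem pair_succ_zero (a : ℕ) : Nat.pair (a + 1) 0 = Nat.pair a (a + 1) + 1 := by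
  simp [Nat.pair]; ring

theorem pair_succ_right {a b : ℕ} (h : b < a) : Nat.pair a (b + 1) = Nat.pair a b + 1 := by
  simp [Nat.pair, h.not_gt, Nat.not_lt.2 (Nat.succ_le_of_lt h)]; ring

/-! ### Standard structures -/

/-- The structure on `A` is induced along the injection `e : A → {0, …, G}` from the intended
structure on the natural numbers, with `G` marked as the output. -/
structure IsStandard {A : Type*} [runLang.Structure A] (G : ℕ) (e : A → ℕ) : Prop where
  injective : Function.Injective e
  le (a : A) : e a ≤ G
  tag {i : Fin 5} {a : A} : Tag i a ↔ e a = i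
  out {a : A} : Out a ↔ e a = G
  lt {a b : A} : Lt a b ↔ e a < e b
  succ {a b : A} : Succ a b ↔ e b = e a + 1
  pair {a b p : A} : Pair a b p ↔ e p = Nat.pair (e a) (e b)
  eval {c a b : A} : Eval c a b ↔ e b ∈ (numCode (e c)).eval (e a)

theorem val_three : ((3 : Fin 5) : ℕ) = 3 := rfl

theorem val_four : ((4 : Fin 5) : ℕ) = 4 := rfl

/-- The rules are true of the natural numbers, and universal sentences pass to restrictions. -/
theorem IsStandard.obeysRules {A : Type*} [runLang.Structure A] {G : ℕ} {e : A → ℕ}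
    (h : IsStandard G e) : ObeysRules A where
  total a b := by
    rw [h.lt, h.lt, ← h.injective.eq_iff]; exact lt_trichotomy _ _
  lt_of_succ := by simp only [h.lt, h.succ]; omega
  no_between := by simp only [h.lt, h.succ]; omega
  zero_min := by simp only [h.lt, h.tag]; simp +contextual
  lt_succ := by simp only [h.lt, h.succ]; omega
  out_max {a b} := by
    have := h.le b
    simp only [h.lt, h.out]; omega
  tag1 := by simp only [h.tag, h.succ]; simp +contextual
  tag2 := by simp only [h.tag, h.succ]; simp +contextual
  tag3 := by simp only [h.tag, h.succ]; simp +contextual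
  tag4 := by simp only [h.tag, h.succ]; simp +contextual
  pair_zero := by
    simp only [h.tag, h.pair]
    intro a ha
    rw [ha]; rfl
  pair_col := by
    simp only [h.tag, h.pair, h.succ]
    intro z b p b' p' hz hp hb hp'
    rw [hp', hp, hz, hb, Fin.val_zero, pair_zero_succ]
  pair_left := by
    simp only [h.lt, h.pair, h.succ]
    intro a b p a' p' hp ha hlt hp'
    rw [hp', hp, ha, pair_succ_left (ha ▸ hlt)]
  pair_row := by
    simp only [h.tag, h.pair, h.succ]
    intro z a a' p p' hz ha hp hp'
    rw [hp', hp, hz, ha, Fin.val_zero, pair_succ_zero]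
  pair_right := by
    simp only [h.lt, h.pair, h.succ]
    intro a b p b' p' hp hlt hb hp'
    rw [hp', hp, hb, pair_succ_right hlt]
  eval_zero := by
    simp only [h.tag, h.pair, h.eval]
    intro z c a hz hc
    rw [hc, hz, Fin.val_zero, numCode_zero]
    simp [Nat.Partrec.Code.eval, pure, PFun.pure]
  eval_succ := by
    simp only [h.tag, h.pair, h.eval, h.succ]
    intro z t c a b hz ht hc hb
    rw [hc, hz, ht, Fin.val_zero, Fin.val_one, numCode_succ, hb]
    simp [Nat.Partrec.Code.eval]
  eval_left := by
    simp only [h.tag, h.pair, h.eval]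
    intro z t c a b p hz ht hc hp
    rw [hc, hz, ht, Fin.val_zero, Fin.val_two, numCode_left, hp]
    simp [Nat.Partrec.Code.eval]
  eval_right := by
    simp only [h.tag, h.pair, h.eval]
    intro z t c a b p hz ht hc hp
    rw [hc, hz, ht, Fin.val_zero, val_three, numCode_right, hp]
    simp [Nat.Partrec.Code.eval]
  eval_pair := by
    simp only [h.tag, h.pair, h.eval]
    intro t f g p c a y z w ht hp hc hy hz hw
    rw [hc, hp, ht, Fin.val_one, numCode_pair]
    exact mem_eval_pair.2 ⟨_, hy, _, hz, hw.symm⟩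
  eval_comp := by
    simp only [h.tag, h.pair, h.eval]
    intro t f g p c a y z ht hp hc hy hz
    rw [hc, hp, ht, Fin.val_two, numCode_comp]
    exact mem_eval_comp.2 ⟨_, hy, hz⟩
  eval_prec_zero := by
    simp only [h.tag, h.pair, h.eval]
    intro t f g p c z a x y ht hp hc hz hx hy
    rw [hc, hp, ht, hx, hz, Fin.val_zero, val_three, numCode_prec,
      Nat.Partrec.Code.eval_prec_zero]
    exact hy
  eval_prec_succ := by
    simp only [h.tag, h.pair, h.eval, h.succ]
    intro t f g p c m n a x x' y u w z ht hp hc hn hx hx' hy hu hw hz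
    rw [hc, hp, ht, hx, val_three, numCode_prec] at hy
    rw [hw, hu] at hz
    rw [hc, hp, ht, hx', hn, val_three, numCode_prec]
    exact mem_eval_prec_succ.2 ⟨_, hy, hz⟩
  eval_rfind_zero := by
    simp only [h.tag, h.pair, h.eval]
    intro t f c a m x z ht hc hx hz hz0
    rw [hx, hz0, Fin.val_zero] at hz
    rw [hc, ht, hx, val_four, numCode_rfind']
    exact mem_eval_rfind'_of_zero hz
  eval_rfind_succ := by
    simp only [h.tag, h.pair, h.eval, h.succ]
    intro t f c a m x y u n x' w ht hc hx hy hu hn hx' hw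
    rw [hx, hu] at hy
    rw [hc, ht, hx', hn, val_four, numCode_rfind'] at hw
    rw [hc, ht, hx, val_four, numCode_rfind']
    exact mem_eval_rfind'_of_succ hy hw

/-! ### What the rules force on a chain of successors -/

/-- The elements `s 0, s 1, …` are a zero of `M` and its iterated successors. -/
structure IsChain {M : Type*} [runLang.Structure M] (s : ℕ → M) : Prop where
  zero : Tag 0 (s 0)
  succ (k : ℕ) : Succ (s k) (s (k + 1))

namespace IsChain

variable {M : Type*} [runLang.Structure M] {s : ℕ → M}

theorem lt (hs : IsChain s) (h : ObeysRules M) {a b : ℕ} (hab : a < b) : Lt (s a) (s b) := by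
  induction b, hab using Nat.le_induction with
  | base => exact h.lt_of_succ (hs.succ a)
  | succ b _ ih => exact h.lt_succ ih (hs.succ b)

theorem tag (hs : IsChain s) (h : ObeysRules M) (i : Fin 5) : Tag i (s i) := by
  have h1 := h.tag1 hs.zero (hs.succ 0)
  have h2 := h.tag2 h1 (hs.succ 1)
  have h3 := h.tag3 h2 (hs.succ 2)
  have h4 := h.tag4 h3 (hs.succ 3)
  fin_cases i
  exacts [hs.zero, h1, h2, h3, h4]

/-- Along the enumeration of pairs, each rule for `Pair` passes from one pair to the next. -/
theorem pair (hs : IsChain s) (h : ObeysRules M) (a b : ℕ) :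
    Pair (s a) (s b) (s (Nat.pair a b)) := by
  induction hp : Nat.pair a b generalizing a b with
  | zero =>
    obtain ⟨rfl, rfl⟩ : a = 0 ∧ b = 0 := Nat.pair_eq_pair.1 (hp.trans (by rfl : 0 = Nat.pair 0 0))
    exact h.pair_zero hs.zero
  | succ p ih =>
    rcases lt_or_ge a b with hab | hab
    · obtain ⟨b, rfl⟩ := Nat.exists_eq_succ_of_ne_zero (Nat.ne_zero_of_lt hab)
      cases a with
      | zero =>
        rw [Nat.succ_eq_add_one, pair_zero_succ] at hp
        exact h.pair_col hs.zero (ih b b (Nat.succ_injective hp)) (hs.succ b) (hs.succ p)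
      | succ a =>
        rw [pair_succ_left hab] at hp
        exact h.pair_left (ih _ _ (Nat.succ_injective hp)) (hs.succ a) (hs.lt h hab) (hs.succ p)
    · cases b with
      | zero =>
        cases a with
        | zero => exact absurd hp (by simp [Nat.pair])
        | succ a =>
          rw [pair_succ_zero] at hp
          exact h.pair_row hs.zero (hs.succ a) (ih _ _ (Nat.succ_injective hp)) (hs.succ p)
      | succ b =>
        rw [pair_succ_right hab] at hp
        exact h.pair_right (ih _ _ (Nat.succ_injective hp)) (hs.lt h hab) (hs.succ b) (hs.succ p)

/-- The Horn rules derive every true computation. -/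
theorem eval (hs : IsChain s) (h : ObeysRules M) {c : Nat.Partrec.Code} {a y : ℕ}
    (hy : y ∈ c.eval a) : Eval (s (codeNum c)) (s a) (s y) := by
  induction c generalizing a y with
  | zero =>
    obtain rfl : y = 0 := by simpa [Nat.Partrec.Code.eval, pure, PFun.pure] using hy
    exact h.eval_zero hs.zero (hs.pair h 0 0)
  | succ =>
    obtain rfl : y = a + 1 := by simpa [Nat.Partrec.Code.eval] using hy
    exact h.eval_succ hs.zero (hs.tag h 1) (hs.pair h 0 1) (hs.succ a)
  | left =>
    obtain rfl : y = a.unpair.1 := by simpa [Nat.Partrec.Code.eval] using hy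
    have := hs.pair h a.unpair.1 a.unpair.2
    rw [Nat.pair_unpair] at this
    exact h.eval_left hs.zero (hs.tag h 2) (hs.pair h 0 2) this
  | right =>
    obtain rfl : y = a.unpair.2 := by simpa [Nat.Partrec.Code.eval] using hy
    have := hs.pair h a.unpair.1 a.unpair.2
    rw [Nat.pair_unpair] at this
    exact h.eval_right hs.zero (hs.tag h 3) (hs.pair h 0 3) this
  | pair f g hf hg =>
    obtain ⟨u, hu, v, hv, rfl⟩ := mem_eval_pair.1 hy
    exact h.eval_pair (hs.tag h 1) (hs.pair h _ _) (hs.pair h 1 _) (hf hu) (hg hv) (hs.pair h _ _)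
  | comp f g hf hg =>
    obtain ⟨u, hu, hv⟩ := mem_eval_comp.1 hy
    exact h.eval_comp (hs.tag h 2) (hs.pair h _ _) (hs.pair h 2 _) (hg hu) (hf hv)
  | prec f g hf hg =>
    obtain ⟨⟨b, m⟩, rfl⟩ : ∃ p : ℕ × ℕ, Nat.pair p.1 p.2 = a := ⟨a.unpair, Nat.pair_unpair a⟩
    induction m generalizing y with
    | zero =>
      rw [Nat.Partrec.Code.eval_prec_zero] at hy
      exact h.eval_prec_zero (hs.tag h 3) (hs.pair h _ _) (hs.pair h 3 _) hs.zero (hs.pair h b 0)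
        (hf hy)
    | succ m ih =>
      obtain ⟨u, hu, hv⟩ := mem_eval_prec_succ.1 hy
      exact h.eval_prec_succ (hs.tag h 3) (hs.pair h _ _) (hs.pair h 3 _) (hs.succ m)
        (hs.pair h b m) (hs.pair h b (m + 1)) (ih hu) (hs.pair h m u) (hs.pair h b _) (hg hv)
  | rfind' f hf =>
    obtain ⟨⟨b, m⟩, rfl⟩ : ∃ p : ℕ × ℕ, Nat.pair p.1 p.2 = a := ⟨a.unpair, Nat.pair_unpair a⟩
    obtain ⟨k, ⟨h0, hk⟩, rfl⟩ := mem_eval_rfind'.1 hy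
    clear hy
    induction k generalizing m with
    | zero =>
      rw [zero_add] at h0 ⊢
      exact h.eval_rfind_zero (hs.tag h 4) (hs.pair h 4 _) (hs.pair h b m) (hf h0) hs.zero
    | succ k ih =>
      obtain ⟨u, hu⟩ := hk 0 k.succ_pos
      rw [zero_add] at hu
      have hrec := ih (m + 1) (by rwa [add_assoc, add_comm 1] at h0) fun i hi => by
        have := hk (i + 1) (by omega)
        rwa [add_assoc, add_comm 1] at this
      rw [show k + (m + 1) = k + 1 + m by ring] at hrec
      exact h.eval_rfind_succ (hs.tag h 4) (hs.pair h 4 _) (hs.pair h b m) (hf hu) (hs.succ u)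
        (hs.succ m) (hs.pair h b (m + 1)) hrec

end IsChain

/-! ### The sentences -/

/-- For `c = codeNum d`, the universal sentence saying that every value computed by `d` at `n` is
an output; the variables `0, …, n` run through the first `n + 1` numbers, `n + 1` is the value. -/
def outSentence (n : ℕ) (c : Fin (n + 1)) : runLang.Sentence :=
  (tagF 0 0 ⟹
    (List.finRange n).foldr (fun i φ => succF i.castSucc.castSucc i.succ.castSucc ⟹ φ)
      (evalF c.castSucc (Fin.last n).castSucc (Fin.last (n + 1)) ⟹
        outF (Fin.last (n + 1)))).alls

theorem realize_foldr_imp {L : FirstOrder.Language} {M : Type*} [L.Structure M] {α ι : Type*}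
    {q : ℕ} (l : List ι) (P : ι → L.BoundedFormula α q) (φ : L.BoundedFormula α q) (v : α → M)
    (xs : Fin q → M) :
    (l.foldr (fun i φ => P i ⟹ φ) φ).Realize v xs ↔
      (∀ i ∈ l, (P i).Realize v xs) → φ.Realize v xs := by
  induction l with
  | nil => simp
  | cons i l ih => simp [ih]

theorem realize_outSentence {M : Type*} [runLang.Structure M] {n : ℕ} {c : Fin (n + 1)} :
    M ⊨ outSentence n c ↔ ∀ xs : Fin (n + 2) → M, Tag 0 (xs 0) →
      (∀ i : Fin n, Succ (xs i.castSucc.castSucc) (xs i.succ.castSucc)) →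
      Eval (xs c.castSucc) (xs (Fin.last n).castSucc) (xs (Fin.last (n + 1))) →
      Out (xs (Fin.last (n + 1))) := by
  rw [Sentence.Realize, outSentence, BoundedFormula.realize_alls]
  simp [realize_foldr_imp]

/-- There are a zero and an output, and every element that is not maximal has a successor. -/
def completeSentence : runLang.Sentence :=
  (tagF 0 (0 : Fin 1)).ex ⊓
    ((outF (0 : Fin 1)).ex ⊓ (ltF (0 : Fin 2) 1 ⟹ (succF (0 : Fin 3) 2).ex).all.all)

theorem realize_completeSentence {M : Type*} [runLang.Structure M] :
    M ⊨ completeSentence ↔ (∃ a : M, Tag 0 a) ∧ (∃ a : M, Out a) ∧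
      ∀ a b : M, Lt a b → ∃ c : M, Succ a c := by
  simp [Sentence.Realize, Formula.Realize, completeSentence, Fin.snoc]

/-- The sentence that has finite cores in all models, but no small ones in the standard model. -/
def runSentence (n : ℕ) (c : Fin (n + 1)) : runLang.Sentence :=
  rulesSentence ⟹ outSentence n c ⟹ completeSentence

theorem realize_runSentence {M : Type*} [runLang.Structure M] {n : ℕ} {c : Fin (n + 1)} :
    M ⊨ runSentence n c ↔
      (M ⊨ rulesSentence → M ⊨ outSentence n c → M ⊨ completeSentence) := Iff.rfl

/-! ### Length of the sentences -/

section Length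

variable {L : FirstOrder.Language} {α : Type*} {q : ℕ}

theorem length_imp_le (φ ψ : L.BoundedFormula α q) :
    length (φ ⟹ ψ) ≤ length φ + length ψ + 1 := by
  cases ψ <;> simp only [length] <;> omega

theorem length_alls (φ : L.BoundedFormula α q) : length φ.alls = length φ + 2 * q := by
  induction q with
  | zero => rfl
  | succ q ih => rw [BoundedFormula.alls, ih, length]; ring

theorem length_atom {k : ℕ} (r : RunRel k) (w : Fin k → Fin q) : length (atom r w) = k + 1 := by
  simp [atom, length, termLength, add_comm]

theorem length_foldr_imp_le {ι : Type*} {m : ℕ} (l : List ι) (P : ι → L.BoundedFormula α q)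
    (φ : L.BoundedFormula α q) (hP : ∀ i, length (P i) ≤ m) :
    length (l.foldr (fun i φ => P i ⟹ φ) φ) ≤ length φ + (m + 1) * l.length := by
  induction l with
  | nil => simp
  | cons i l ih =>
    have h₁ := length_imp_le (P i) (l.foldr (fun i φ => P i ⟹ φ) φ)
    have h₂ := hP i
    rw [List.foldr_cons, List.length_cons, mul_add]
    omega

end Length

theorem length_outSentence_le (n : ℕ) (c : Fin (n + 1)) :
    length (outSentence n c) ≤ 6 * n + 15 := by
  have h : length (outSentence n c) ≤
      1 + 1 + ((3 + 1 + (1 + 1) + 1) + (2 + 1 + 1) * (List.finRange n).length) + 1 +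
        2 * (n + 2) := by
    rw [outSentence, length_alls]
    gcongr
    refine (length_imp_le _ _).trans ?_
    gcongr
    · exact (length_atom _ _).le
    refine (length_foldr_imp_le _ _ _ fun _ => (length_atom _ _).le).trans ?_
    gcongr
    · refine (length_imp_le _ _).trans ?_
      gcongr
      · exact (length_atom _ _).le
      · exact (length_atom _ _).le
  rw [List.length_finRange] at h
  omega

/-- The length of `runSentence n c` grows at most linearly in `n`, uniformly in `c`. -/
theorem length_runSentence_le (n : ℕ) (c : Fin (n + 1)) :
    length (runSentence n c) ≤ 6 * n + (length rulesSentence + length completeSentence + 17) := by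
  have h₁ := length_imp_le (outSentence n c) completeSentence
  have h₂ := length_imp_le rulesSentence (outSentence n c ⟹ completeSentence)
  have h₃ := length_outSentence_le n c
  rw [runSentence]
  omega

/-! ### Complete structures are finite -/

/-- In an infinite complete structure the successors of zero never end, so the rules derive the
computation of `d` at `n`, whose value would be an output without being maximal. -/
theorem finite_of_complete {M : Type*} [runLang.Structure M] {d : Nat.Partrec.Code} {n G : ℕ}
    (hn : codeNum d < n + 1) (hG : G ∈ d.eval n) (h : ObeysRules M)
    (hout : M ⊨ outSentence n ⟨codeNum d, hn⟩) (hM : M ⊨ completeSentence) : Finite M := by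
  classical
  obtain ⟨⟨z, hz⟩, -, hsucc⟩ := realize_completeSentence.1 hM
  rw [realize_outSentence] at hout
  let next (a : M) : M := if h : ∃ b, Succ a b then h.choose else a
  have hnext {a : M} (ha : ∃ b, Succ a b) : Succ a (next a) := by
    simp only [next, dif_pos ha]; exact ha.choose_spec
  let s (k : ℕ) : M := next^[k] z
  have s_succ (k : ℕ) : s (k + 1) = next (s k) := Function.iterate_succ_apply' next k z
  -- Either the iterated successors of zero form a chain, or they stop and exhaust `M`.
  by_cases hall : ∀ k, ∃ b, Succ (s k) b
  · have hs : IsChain s := ⟨hz, fun k => by rw [s_succ]; exact hnext (hall k)⟩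
    have hO := hout (Fin.snoc (fun i : Fin (n + 1) => s i) (s G)) (by
        have := Fin.snoc_castSucc (α := fun _ => M) (s G) (fun i : Fin (n + 1) => s i) 0
        rw [Fin.castSucc_zero] at this
        rw [this]; exact hz)
      (fun i => by rw [Fin.snoc_castSucc, Fin.snoc_castSucc]; exact hs.succ i)
      (by rw [Fin.snoc_castSucc, Fin.snoc_castSucc, Fin.snoc_last]; exact hs.eval h hG)
    rw [Fin.snoc_last] at hO
    exact absurd (hs.lt h G.lt_succ_self) (h.out_max hO)
  · push Not at hall
    obtain ⟨k, hk⟩ := hall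
    have key (j : ℕ) (a : M) : a ∈ s '' Set.Iic j ∨ Lt (s j) a := by
      induction j with
      | zero =>
        rcases h.total (s 0) a with h1 | h1 | h1
        · exact .inr h1
        · exact .inl ⟨0, by simp, h1⟩
        · exact absurd h1 (h.zero_min hz)
      | succ j ih =>
        rcases ih with ⟨i, hi, rfl⟩ | ih
        · exact .inl ⟨i, (Set.mem_Iic.1 hi).trans j.le_succ, rfl⟩
        · rcases h.total (s (j + 1)) a with h1 | h1 | h1
          · exact .inr h1
          · exact .inl ⟨j + 1, by simp, h1⟩
          · have hj : Succ (s j) (s (j + 1)) := by rw [s_succ]; exact hnext (hsucc _ _ ih)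
            exact absurd h1 (h.no_between hj ih)
    refine Set.finite_univ_iff.1 (((Set.finite_Iic k).image s).subset fun a _ => ?_)
    rcases key k a with h1 | h1
    · exact h1
    · obtain ⟨b, hb⟩ := hsucc _ _ h1
      exact absurd hb (hk b)

/-! ### Finite cores -/

/-- A failure of a universal sentence is witnessed by a finite set, hence persists in every
substructure containing that set. -/
theorem exists_finset_not_realize_alls {L : FirstOrder.Language} {M : Type*} [L.Structure M]
    {q : ℕ} {φ : L.BoundedFormula Empty q} (hφ : φ.IsQF) (h : ¬ M ⊨ φ.alls) :
    ∃ C : Finset M, ∀ N : L.Substructure M, (C : Set M) ⊆ N → ¬ N ⊨ φ.alls := by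
  classical
  simp only [Sentence.Realize, BoundedFormula.realize_alls, not_forall] at h ⊢
  obtain ⟨xs, hxs⟩ := h
  refine ⟨Finset.univ.image xs, fun N hN => ⟨fun i => ⟨xs i, hN (by simp)⟩, fun hr => hxs ?_⟩⟩
  rw [← hφ.realize_embedding N.subtype] at hr
  convert hr
  rfl

theorem isQF_foldr_inf {L : FirstOrder.Language} {α : Type*} {q : ℕ}
    {l : List (L.BoundedFormula α q)} (hl : ∀ φ ∈ l, φ.IsQF) : (l.foldr (· ⊓ ·) ⊤).IsQF := by
  induction l with
  | nil => exact .top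
  | cons φ l ih =>
    rw [List.forall_mem_cons] at hl
    exact hl.1.inf (ih hl.2)

theorem isQF_rules : ∀ φ ∈ rules, φ.IsQF := by
  simp only [rules, List.forall_mem_cons, List.not_mem_nil, false_imp_iff, implies_true, and_true]
  refine ⟨(isQF_atom _ _).sup ((isQF_eqF _ _).sup (isQF_atom _ _)), ?_⟩
  refine ⟨?_, ?_, ?_, ?_, ?_, ?_, ?_, ?_, ?_, ?_, ?_, ?_, ?_, ?_, ?_, ?_, ?_, ?_, ?_, ?_, ?_, ?_,
    ?_, ?_⟩ <;>
  repeat' first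
    | exact isQF_atom _ _
    | exact (isQF_atom _ _).not
    | refine BoundedFormula.IsQF.imp (isQF_atom _ _) ?_

theorem isQF_foldr_imp {L : FirstOrder.Language} {α ι : Type*} {q : ℕ} (l : List ι)
    {P : ι → L.BoundedFormula α q} {φ : L.BoundedFormula α q} (hP : ∀ i, (P i).IsQF)
    (hφ : φ.IsQF) : (l.foldr (fun i φ => P i ⟹ φ) φ).IsQF := by
  induction l with
  | nil => exact hφ
  | cons i l ih => exact (hP i).imp ih

/-- If a universal premise fails, a finite set witnesses it; otherwise the model is complete, hence
finite, and is its own core. -/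
theorem runSentence_mem_PSCf {d : Nat.Partrec.Code} {n G : ℕ}
    (hn : codeNum d < n + 1) (hG : G ∈ d.eval n) :
    runSentence n ⟨codeNum d, hn⟩ ∈ PSCf.{x, 0, 0} runLang := by
  classical
  rintro M _ _ ⟨-, hM⟩
  change M ⊨ runSentence n _ at hM
  rw [realize_runSentence] at hM
  by_cases h₁ : M ⊨ rulesSentence
  · by_cases h₂ : M ⊨ outSentence n ⟨codeNum d, hn⟩
    · have := finite_of_complete hn hG (realize_rulesSentence.1 h₁) h₂ (hM h₁ h₂)
      have := Fintype.ofFinite M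
      refine ⟨Finset.univ, fun N hN hC => ⟨hN.to_subtype, ?_⟩⟩
      obtain rfl : N = ⊤ := top_unique fun a _ => hC (Finset.mem_univ a)
      change (⊤ : runLang.Substructure M) ⊨ runSentence n _
      rw [StrongHomClass.realize_sentence Substructure.topEquiv, realize_runSentence]
      exact hM
    · obtain ⟨C, hC⟩ := exists_finset_not_realize_alls
        ((isQF_atom _ _).imp (isQF_foldr_imp _ (fun _ => isQF_atom _ _)
          ((isQF_atom _ _).imp (isQF_atom _ _)))) h₂
      exact ⟨C, fun N hN hCN => ⟨hN.to_subtype, fun _ h => absurd h (hC N hCN)⟩⟩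
  · obtain ⟨C, hC⟩ := exists_finset_not_realize_alls (isQF_foldr_inf isQF_rules) h₁
    exact ⟨C, fun N hN hCN => ⟨hN.to_subtype, fun h => absurd h (hC N hCN)⟩⟩

/-! ### The standard model has no small core -/

/-- The intended meaning of the symbols in `ℕ`, with `G` marked as the output. -/
def natRel (G : ℕ) : {k : ℕ} → RunRel k → (Fin k → ℕ) → Prop
  | _, .tag i, w => w 0 = i
  | _, .out, w => w 0 = G
  | _, .lt, w => w 0 < w 1
  | _, .succ, w => w 1 = w 0 + 1
  | _, .pair, w => w 2 = Nat.pair (w 0) (w 1)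
  | _, .eval, w => w 2 ∈ (numCode (w 0)).eval (w 1)

/-- The restriction of the intended structure on `ℕ` to `{0, …, G}`. -/
@[reducible] def standardStructure (G : ℕ) : runLang.Structure (ULift.{x} (Fin (G + 1))) where
  funMap f := (show Empty from f).elim
  RelMap r w := natRel G (show RunRel _ from r) fun i => (w i).down

theorem isStandard_standardStructure (G : ℕ) :
    let := standardStructure.{x} G
    IsStandard (A := ULift.{x} (Fin (G + 1))) G fun a => a.down :=
  letI := standardStructure.{x} G
  { injective := Fin.val_injective.comp ULift.down_injective
    le := fun a => Nat.le_of_lt_succ a.down.2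
    tag := Iff.rfl
    out := Iff.rfl
    lt := Iff.rfl
    succ := Iff.rfl
    pair := Iff.rfl
    eval := Iff.rfl }

namespace IsStandard

variable {A : Type*} [runLang.Structure A] {G : ℕ} {e : A → ℕ}

theorem holds_coe {N : runLang.Substructure A} {k : ℕ} {r : RunRel k} {w : Fin k → N} :
    Holds r w ↔ Holds r fun i => (w i : A) := Iff.rfl

theorem restrict (h : IsStandard G e) (N : runLang.Substructure A) :
    IsStandard G fun a : N => e a where
  injective := h.injective.comp Subtype.val_injective
  le a := h.le a
  tag {i a} := by
    rw [← h.tag, Tag, holds_coe, ← Function.comp_def, ← FinVec.map_eq]; rfl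
  out := by
    intros; rw [← h.out, Out, holds_coe, ← Function.comp_def, ← FinVec.map_eq]; rfl
  lt := by
    intros; rw [← h.lt, Lt, holds_coe, ← Function.comp_def, ← FinVec.map_eq]; rfl
  succ := by
    intros; rw [← h.succ, Succ, holds_coe, ← Function.comp_def, ← FinVec.map_eq]; rfl
  pair := by
    intros; rw [← h.pair, Pair, holds_coe, ← Function.comp_def, ← FinVec.map_eq]; rfl
  eval := by
    intros; rw [← h.eval, Eval, holds_coe, ← Function.comp_def, ← FinVec.map_eq]; rfl

theorem realize_outSentence (h : IsStandard G e) {d : Nat.Partrec.Code} {n : ℕ}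
    (hn : codeNum d < n + 1) (hG : G ∈ d.eval n) : A ⊨ outSentence n ⟨codeNum d, hn⟩ := by
  rw [CoveredExt.realize_outSentence]
  intro xs h0 hs he
  have key (i : Fin (n + 1)) : e (xs i.castSucc) = i := by
    induction i using Fin.induction with
    | zero => exact h.tag.1 h0
    | succ i ih => rw [h.succ.1 (hs i), ih]; simp
  rw [h.eval, key, key, numCode_codeNum] at he
  exact h.out.2 (Part.mem_unique he hG)

/-- A restriction of the standard model is complete only if nothing is missing. -/
theorem exists_eq_of_complete (h : IsStandard G e) (hA : A ⊨ completeSentence) {m : ℕ}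
    (hm : m ≤ G) : ∃ a, e a = m := by
  obtain ⟨⟨z, hz⟩, ⟨o, ho⟩, hs⟩ := realize_completeSentence.1 hA
  induction m with
  | zero => exact ⟨z, h.tag.1 hz⟩
  | succ m ih =>
    obtain ⟨a, rfl⟩ := ih (by omega)
    obtain ⟨b, hb⟩ := hs a o (h.lt.2 (by rw [h.out.1 ho]; omega))
    exact ⟨b, h.succ.1 hb⟩

end IsStandard

/-- Every core of the standard model is the whole model, which has `G + 1` elements. -/
theorem runSentence_notMem_PSC {d : Nat.Partrec.Code} {n G k : ℕ}
    (hn : codeNum d < n + 1) (hG : G ∈ d.eval n) (hk : k < G) :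
    runSentence n ⟨codeNum d, hn⟩ ∉ PSC.{x, 0, 0} runLang k := by
  intro hPSC
  let := standardStructure.{x} G
  have hstd := isStandard_standardStructure.{x} G
  obtain ⟨C, hCk, hC⟩ := hPSC (ULift.{x} (Fin (G + 1))) ⟨⟨⟨0⟩⟩, fun _ _ =>
    realize_completeSentence.2 ⟨⟨⟨0⟩, hstd.tag.2 rfl⟩, ⟨⟨Fin.last G⟩, hstd.out.2 rfl⟩,
      fun a b hab => ⟨⟨⟨a.down + 1, by
        have := hstd.lt.1 hab
        have := b.down.2
        omega⟩⟩, hstd.succ.2 rfl⟩⟩⟩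
  obtain ⟨m, hm⟩ : ∃ m, m ∉ C := by
    by_contra! hall
    obtain rfl : C = Finset.univ := Finset.eq_univ_of_forall hall
    rw [Finset.card_univ, Fintype.card_ulift, Fintype.card_fin] at hCk
    omega
  -- Deleting an element outside the core destroys completeness, but not the universal sentences.
  let N : runLang.Substructure (ULift.{x} (Fin (G + 1))) :=
    ⟨{m}ᶜ, fun f => (show Empty from f).elim⟩
  have hN : (N : Set (ULift.{x} (Fin (G + 1)))).Nonempty := by
    have : Nontrivial (Fin (G + 1)) := Fin.nontrivial_iff_two_le.2 (by omega)
    exact exists_ne m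
  have : Nonempty N := hN.to_subtype
  have hNstd := hstd.restrict N
  obtain ⟨a, ha⟩ := hNstd.exists_eq_of_complete
    ((hC N hN fun a ha h => hm (Set.mem_singleton_iff.1 h ▸ ha)).2
      ((realize_rulesSentence (M := N)).2 hNstd.obeysRules)
      (hNstd.realize_outSentence hn hG)) (hstd.le m)
  exact a.2 (hstd.injective ha)

/-! ### Duality between covered extensions and cores -/

section Duality

variable {L : FirstOrder.Language.{0, 0}} {φ : L.Sentence}

theorem neg_mem_PCEf_of_mem_PSCf (h : φ ∈ PSCf.{x, 0, 0} L) : φ.not ∈ PCEf.{x, 0, 0} L := by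
  refine fun M hM₀ _ R hR hN => ⟨hM₀, fun hM => ?_⟩
  obtain ⟨C, hC⟩ := h M ⟨hM₀, hM⟩
  obtain ⟨N, hNR, hCN⟩ := hR.2 C
  exact (hN N hNR).2 (hC N (hR.1 N hNR) hCN).2

theorem mem_PSC_of_neg_mem_PCE {k : ℕ} (h : φ.not ∈ PCE.{x, 0, 0} L k) :
    φ ∈ PSC.{x, 0, 0} L k := by
  rintro M _ _ ⟨-, hM⟩
  by_contra! hC
  -- If no small set is a core, then `M` is covered by its substructures refuting `φ`.
  have hcov (A : Finset M) (hA : A.card ≤ k) : ∃ N : L.Substructure M,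
      ((N : Set M).Nonempty ∧ ¬ N ⊨ φ) ∧ (A : Set M) ⊆ N := by
    have := hC A hA
    simp only [IsCore, not_forall] at this
    obtain ⟨N, hN, hAN, hφ⟩ := this
    exact ⟨N, ⟨hN, fun h => hφ ⟨hN.to_subtype, h⟩⟩, hAN⟩
  exact (h M {N | (N : Set M).Nonempty ∧ ¬ N ⊨ φ}
    ⟨(hcov ∅ (by simp)).imp fun _ h => h.1, fun _ h => h.1, hcov⟩
    fun N hN => ⟨hN.1.to_subtype, hN.2⟩).2 hM

end Duality

/-! ### Outgrowing a computable function -/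

/-- A linear length bound stays below `n * n` for large `n`, and the sum of the values of `f` up to
`n * n + 1` is computable, hence computed by some program `d`. -/
theorem exists_sentence_without_small_cores (f : ℕ → ℕ) (hf : Computable f) :
    ∃ φ : runLang.Sentence, φ ∈ PSCf.{x, 0, 0} runLang ∧
      ∀ l ≤ length φ + 1, ∀ k ≤ f l, φ ∉ PSC.{x, 0, 0} runLang k := by
  let F (n : ℕ) : ℕ := ∑ m ∈ Finset.range (n * n + 2), f m
  have hsum : Computable fun k => ∑ m ∈ Finset.range k, f m := by
    have : Computable₂ fun (_ : ℕ) (p : ℕ × ℕ) => p.2 + f p.1 :=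
      (Primrec.nat_add.to_comp.comp (Computable.snd.comp Computable.snd)
        (hf.comp (Computable.fst.comp Computable.snd)))
    refine (Computable.nat_rec Computable.id (Computable.const 0) this).of_eq fun k => ?_
    induction k with
    | zero => simp
    | succ k ih => rw [Finset.sum_range_succ, ← ih]; rfl
  have hF : Computable fun n => F n + 1 :=
    Computable.succ.comp (hsum.comp (Computable.succ.comp (Computable.succ.comp
      (Primrec.nat_mul.to_comp.comp Computable.id Computable.id))))
  obtain ⟨d, hd⟩ := Nat.Partrec.Code.exists_code.1 (Partrec.nat_iff.1 hF.partrec)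
  set B := length rulesSentence + length completeSentence + 17 with hB
  -- `n ≥ codeNum d` lets `outSentence` name the program, and `n ≥ B ≥ 7` makes `6 * n + B ≤ n * n`.
  let n := B + codeNum d
  have hn : codeNum d < n + 1 := by omega
  have hG : F n + 1 ∈ d.eval n := by rw [hd]; exact Part.mem_some _
  refine ⟨_, runSentence_mem_PSCf hn hG, fun l hl k hk => runSentence_notMem_PSC hn hG ?_⟩
  have hlen := length_runSentence_le n ⟨codeNum d, hn⟩
  have hnn : 7 * n ≤ n * n := Nat.mul_le_mul_right n (by omega)
  exact Nat.lt_succ_of_le (hk.trans (Finset.single_le_sum (f := f) (fun _ _ => Nat.zero_le _)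
    (Finset.mem_range.2 (by omega))))

end CoveredExt

theorem mainTheorem10 (f : ℕ → ℕ) (hf : Computable f) :
    (∃ (L : FirstOrder.Language.{0, 0}) (_ : Finite L.Symbols) (φ : L.Sentence),
      φ ∈ CoveredExt.PCEf.{x, 0, 0} L ∧
        ∀ k ≤ f (CoveredExt.length φ), φ ∉ CoveredExt.PCE.{x, 0, 0} L k) ∧
    (∃ (L : FirstOrder.Language.{0, 0}) (_ : Finite L.Symbols) (φ : L.Sentence),
      φ ∈ CoveredExt.PSCf.{x, 0, 0} L ∧
        ∀ k ≤ f (CoveredExt.length φ), φ ∉ CoveredExt.PSC.{x, 0, 0} L k) := by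
  obtain ⟨φ, hφ, hk⟩ := CoveredExt.exists_sentence_without_small_cores.{x} f hf
  refine ⟨⟨CoveredExt.runLang, inferInstance, φ.not, CoveredExt.neg_mem_PCEf_of_mem_PSCf hφ,
    fun k hkf h => hk _ le_rfl k ?_ (CoveredExt.mem_PSC_of_neg_mem_PCE h)⟩,
    ⟨CoveredExt.runLang, inferInstance, φ, hφ, hk _ (Nat.le_succ _)⟩⟩
  exact hkf
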